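/- Let $d$ be a prime, $\omega=\exp(2\pi\mathrm{i}/d)$ (where $\mathrm{i}^2=-1$) and $k\ge 0$. Let $T_1,\dots,T_k$ be unitary operators on a nonzero finite-dimensional complex Hilbert space $\mathcal H$ such that $T_i^d=\mathbb 1$ for all $i$ and, for all $i,j$, $T_iT_jT_i^{-1}T_j^{-1}=\omega^{\gamma_{ij}}\mathbb 1$ with $\gamma=(\gamma_{ij})\in M_{k\times k}(\mathbb Z_d)$. For $I\in\mathbb Z_d^k$ put $A_I=\alpha_I\,T_1^{I_1}T_2^{I_2}\cdots T_k^{I_k}$, where $\alpha_I\in\{1,\mathrm{i}\}$ is chosen so that $A_I^d=\mathbb 1$, and let $\mathcal A=\{A_I\}_{I\in\mathbb Z_d^k}$ be the resulting family, a group under $A_I\odot A_J=A_{I+J}$ (sums over $\mathcal A$ are sums over $I\in\mathbb Z_d^k$). Let $\overline G$ be its commutation graph: the simple graph with vertices $I\in\mathbb Z_d^k$ in which $I\ne J$ are joined exactly when $A_IA_J=A_JA_I$. Let $\tilde\omega(\overline G)$ be the number of vertices of a largest clique of $\overline G$, and let $\operatorname{null}(\gamma)$ be the dimension of the kernel of $\gamma$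 over the field $\mathbb Z_d$. Then for every state (density matrix) $\rho$ on $\mathcal H$, with $\langle A\rangle=\operatorname{Tr}(A\rho)$, $$\sum_{A\in\mathcal A}|\langle A\rangle|^2\;\le\; d^{(\operatorname{null}(\gamma)+k)/2}=\tilde\omega(\overline G).$$ Moreover the bound is saturable: for every such $\mathcal A$ there is a pure state $\rho=|\psi\rangle\langle\psi|$ for which equality holds. -/

import Mathlib

open scoped Matrix ComplexOrder

noncomputable section

namespace QuditGroup

/-- The primitive root of unity `ω = exp (2πi / d)`. -/
def omega (d : ℕ) : ℂ :=
  Complex.exp (2 * Real.pi * Complex.I / d)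

/-- The multiplicative commutator `[A, B]_• = A B A⁻¹ B⁻¹`. -/
def mulCommutator {n : Type*} [Fintype n] [DecidableEq n] (A B : Matrix n n ℂ) : Matrix n n ℂ :=
  A * B * A⁻¹ * B⁻¹

/-- The operator `α ∏ᵢ Tᵢ ^ Iᵢ`, the product being taken in the order `i = 0, 1, …, k - 1`. -/
def word {d k : ℕ} {n : Type*} [Fintype n] [DecidableEq n]
    (T : Fin k → Matrix n n ℂ) (α : ℂ) (I : Fin k → ZMod d) : Matrix n n ℂ :=
  α • (List.ofFn fun i => T i ^ (I i).val).prod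

/-- The group `𝒜 = ⟨T₁, …, T_k⟩_⊙` of unitary matrices `A_I = α_I ∏ᵢ Tᵢ ^ Iᵢ`, `I ∈ ℤ_d^k`, given by
its generators `Tᵢ` and its phases `α_I ∈ {1, i}`. The group operation is
`A_I ⊙ A_J = A_{I + J}`, so the elements are indexed by the group `ℤ_d^k`. The fact that any two
elements `A_I`, `A_J` commute up to a power of `ω` follows from `commutator_eq`. -/
structure OpGroup (d k : ℕ) (n : Type*) [Fintype n] [DecidableEq n] where
  /-- the generators -/
  T : Fin k → Matrix n n ℂ
  /-- the phases -/
  α : (Fin k → ZMod d) → ℂ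
  unitary : ∀ i, T i ∈ Matrix.unitaryGroup n ℂ
  pow_eq_one : ∀ i, T i ^ d = 1
  commutator_eq : ∀ i j, ∃ l : ZMod d, mulCommutator (T i) (T j) = omega d ^ l.val • 1
  phase : ∀ I, α I = 1 ∨ α I = Complex.I
  word_pow_eq_one : ∀ I, word T (α I) I ^ d = 1

namespace OpGroup

variable {d k : ℕ} {n : Type*} [Fintype n] [DecidableEq n]

/-- The element `A_I` of the group. -/
def elt (𝒜 : OpGroup d k n) (I : Fin k → ZMod d) : Matrix n n ℂ :=
  word 𝒜.T (𝒜.α I) I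

/-- `γ` is the adjacency matrix of the generating graph: `[Tᵢ, Tⱼ]_• = ω ^ γᵢⱼ 𝟙`. -/
def IsGeneratingMatrix (𝒜 : OpGroup d k n) (γ : Matrix (Fin k) (Fin k) (ZMod d)) : Prop :=
  ∀ i j, mulCommutator (𝒜.T i) (𝒜.T j) = omega d ^ (γ i j).val • 1

/-- The commutation graph: `A_I` and `A_J` are joined iff `I ≠ J` and they commute under the
ordinary matrix multiplication. -/
def commGraph (𝒜 : OpGroup d k n) : SimpleGraph (Fin k → ZMod d) where
  Adj I J := I ≠ J ∧ Commute (𝒜.elt I) (𝒜.elt J)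
  symm := ⟨fun _ _ h => ⟨h.1.symm, h.2.symm⟩⟩
  loopless := ⟨fun _ h => h.1 rfl⟩

/-- The sum of squares `∑_{A ∈ 𝒜} |⟨A⟩|²` with `⟨A⟩ = Tr (A ρ)`. -/
def sumSq [NeZero d] (𝒜 : OpGroup d k n) (ρ : Matrix n n ℂ) : ℝ :=
  ∑ I : Fin k → ZMod d, ‖(𝒜.elt I * ρ).trace‖ ^ 2

end OpGroup

/-- A (possibly mixed) quantum state: a density matrix. -/
def IsState {n : Type*} [Fintype n] (ρ : Matrix n n ℂ) : Prop :=
  ρ.PosSemidef ∧ ρ.trace = 1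

/-- A pure state `|ψ⟩⟨ψ|`. -/
def IsPureState {n : Type*} [Fintype n] (ρ : Matrix n n ℂ) : Prop :=
  IsState ρ ∧ ∃ ψ : n → ℂ, ρ = Matrix.vecMulVec ψ (star ψ)

/-- The nullity of a square matrix: the dimension of its kernel. -/
def nullity {K : Type*} [Field K] {k : ℕ} (γ : Matrix (Fin k) (Fin k) K) : ℕ :=
  Module.finrank K (LinearMap.ker γ.mulVecLin)

end QuditGroup

end

/-!
Write `β(I, J) = I ⬝ᵥ γ *ᵥ J`. The generators commute up to powers of `ω`, so
`A_I A_J = ω ^ β(I, J) A_J A_I` (`elt_mul_elt_comm`) and `A_I A_J` is a unit scalar multiple of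
`A_{I+J}` (`elt_mul_elt`). In particular `β` is alternating, and its radical is `ker γ`.

*Upper bound* (`sumSq_sq_le`). Put `S = ∑_I A_I ⊗ A_I†` on `H ⊗ H`, so that the sum of squares is
`F = Tr(S (ρ ⊗ ρ))`. The variance of `S` in the state `ρ ⊗ ρ` is nonnegative, hence
`F² ≤ Tr(S†S (ρ ⊗ ρ))`. In `S†S = ∑_{I,K} (A_I† A_{I+K}) ⊗ (A_I A_{I+K}†)` the unit scalars cancel
except for the commutation phase, so `S†S = ∑_K (∑_I ω ^ β(K, I)) A_K ⊗ A_K†`. The inner sum is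
`d ^ k` for `K ∈ ker γ` and zero otherwise, and each of the `d ^ null(γ)` remaining terms has
`|⟨A_K⟩|² ≤ 1`. This gives `F² ≤ d ^ (null(γ) + k)`.

*Cliques give states* (`exists_isPureState_card_le_sumSq`). The operators of a clique commute and
have finite order, so they have a joint eigenvector `ψ`. They are unitary, so in the state `|ψ⟩⟨ψ|`
each of them contributes `1` to the sum of squares; the sum is therefore at least the size of the
clique.

*A large clique* (`exists_isClique_card_sq`). A maximal isotropic subspace `W` for `β` equals its own
orthogonal, hence contains `ker γ` and satisfies `2 dim W = null(γ) + k`. It is a clique of size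
`d ^ ((null(γ) + k) / 2)`.

The upper bound then shows that no clique is larger, and that the state attached to `W` attains it.
-/

open scoped Kronecker

namespace QuditGroup

/-! ### Matrices commuting up to scalars -/

section Phases

variable {n : Type*} [Fintype n] [DecidableEq n]

theorem pow_mul_comm_smul {A B : Matrix n n ℂ} {c : ℂ} (h : A * B = c • (B * A)) (m : ℕ) :
    A ^ m * B = c ^ m • (B * A ^ m) := by
  induction m with
  | zero => simp
  | succ m ih =>
    rw [pow_succ, mul_assoc, h, mul_smul_comm, ← mul_assoc, ih, smul_mul_assoc, smul_smul,
      mul_assoc, pow_succ']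

theorem mul_pow_comm_smul {A B : Matrix n n ℂ} {c : ℂ} (h : A * B = c • (B * A)) (m : ℕ) :
    A * B ^ m = c ^ m • (B ^ m * A) := by
  induction m with
  | zero => simp
  | succ m ih =>
    rw [pow_succ, ← mul_assoc, ih, smul_mul_assoc, mul_assoc, h, mul_smul_comm, smul_smul,
      mul_assoc, pow_succ]

theorem prod_ofFn_mul_comm_smul {k : ℕ} (f : Fin k → Matrix n n ℂ) (B : Matrix n n ℂ)
    (c : Fin k → ℂ) (h : ∀ i, f i * B = c i • (B * f i)) :
    (List.ofFn f).prod * B = (∏ i, c i) • (B * (List.ofFn f).prod) := by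
  induction k with
  | zero => simp
  | succ k ih =>
    rw [List.ofFn_succ, List.prod_cons, mul_assoc, ih (fun i => f i.succ) (fun i => c i.succ)
      fun i => h i.succ, mul_smul_comm, ← mul_assoc, h 0, smul_mul_assoc, smul_smul, mul_assoc,
      Fin.prod_univ_succ, mul_comm (c 0)]

theorem mul_prod_ofFn_comm_smul {k : ℕ} (f : Fin k → Matrix n n ℂ) (B : Matrix n n ℂ)
    (c : Fin k → ℂ) (h : ∀ i, B * f i = c i • (f i * B)) :
    B * (List.ofFn f).prod = (∏ i, c i) • ((List.ofFn f).prod * B) := by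
  induction k with
  | zero => simp
  | succ k ih =>
    rw [List.ofFn_succ, List.prod_cons, ← mul_assoc, h 0, smul_mul_assoc, mul_assoc,
      ih (fun i => f i.succ) (fun i => c i.succ) fun i => h i.succ, mul_smul_comm, smul_smul,
      mul_assoc, Fin.prod_univ_succ]

/-- Two ordered products whose factors commute up to unit scalars can be merged factor by factor, at
the cost of a unit scalar. -/
theorem prod_ofFn_mul_prod_ofFn {k : ℕ} (f g : Fin k → Matrix n n ℂ) (c : Fin k → Fin k → ℂ)
    (hc : ∀ i j, ‖c i j‖ = 1) (h : ∀ i j, f i * g j = c i j • (g j * f i)) :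
    ∃ a : ℂ, ‖a‖ = 1 ∧ (List.ofFn f).prod * (List.ofFn g).prod =
      a • (List.ofFn fun i => f i * g i).prod := by
  induction k with
  | zero => exact ⟨1, by simp, by simp⟩
  | succ k ih =>
    obtain ⟨a, ha, e⟩ := ih (fun i => f i.succ) (fun i => g i.succ) (fun i j => c i.succ j.succ)
      (fun i j => hc _ _) fun i j => h _ _
    refine ⟨(∏ i : Fin k, c i.succ 0) * a, by simp [ha, hc], ?_⟩
    have e0 := prod_ofFn_mul_comm_smul (fun i => f i.succ) (g 0) (fun i => c i.succ 0)
      fun i => h _ _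
    simp only [List.ofFn_succ, List.prod_cons]
    calc f 0 * (List.ofFn fun i => f i.succ).prod * (g 0 * (List.ofFn fun i => g i.succ).prod)
        = f 0 * ((List.ofFn fun i => f i.succ).prod * g 0) *
            (List.ofFn fun i => g i.succ).prod := by simp only [mul_assoc]
      _ = (∏ i : Fin k, c i.succ 0) • (f 0 * g 0 *
            ((List.ofFn fun i => f i.succ).prod * (List.ofFn fun i => g i.succ).prod)) := by
          rw [e0]; simp only [mul_smul_comm, smul_mul_assoc, mul_assoc]
      _ = _ := by rw [e, mul_smul_comm, smul_smul]

end Phases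

/-! ### Commutation relations in the group -/

namespace OpGroup

variable {d k : ℕ} {n : Type*} [Fintype n] [DecidableEq n]

theorem omega_pow_val [NeZero d] (x : ZMod d) : omega d ^ x.val = ZMod.stdAddChar x := by
  have := ZMod.stdAddChar_coe (N := d) (x.val : ℤ)
  rw [Int.cast_natCast, ZMod.natCast_zmod_val] at this
  rw [this, omega, ← Complex.exp_nat_mul]
  congr 1
  push_cast
  ring

theorem stdAddChar_sum [NeZero d] {ι : Type*} (s : Finset ι) (f : ι → ZMod d) :
    (ZMod.stdAddChar (∑ i ∈ s, f i) : ℂ) = ∏ i ∈ s, (ZMod.stdAddChar (f i) : ℂ) := by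
  classical
  induction s using Finset.induction_on with
  | empty => simp
  | insert a s ha ih =>
    rw [Finset.sum_insert ha, Finset.prod_insert ha, AddChar.map_add_eq_mul, ih]

theorem norm_α (𝒜 : OpGroup d k n) (I : Fin k → ZMod d) : ‖𝒜.α I‖ = 1 := by
  rcases 𝒜.phase I with h | h <;> simp [h]

theorem elt_eq_smul (𝒜 : OpGroup d k n) (I : Fin k → ZMod d) :
    𝒜.elt I = 𝒜.α I • (List.ofFn fun i => 𝒜.T i ^ (I i).val).prod := rfl

theorem T_mul_T [NeZero d] (𝒜 : OpGroup d k n) {γ : Matrix (Fin k) (Fin k) (ZMod d)}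
    (hγ : 𝒜.IsGeneratingMatrix γ) (i j : Fin k) :
    𝒜.T i * 𝒜.T j = (ZMod.stdAddChar (γ i j) : ℂ) • (𝒜.T j * 𝒜.T i) := by
  have hdet : ∀ i, IsUnit (𝒜.T i).det := fun i =>
    (Matrix.isUnit_iff_isUnit_det _).1 (Unitary.toUnits ⟨𝒜.T i, 𝒜.unitary i⟩).isUnit
  have h := hγ i j
  rw [omega_pow_val, mulCommutator] at h
  calc 𝒜.T i * 𝒜.T j
      = 𝒜.T i * 𝒜.T j * (𝒜.T i)⁻¹ * (𝒜.T j)⁻¹ * (𝒜.T j * 𝒜.T i) := by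
        rw [mul_assoc _ (𝒜.T j)⁻¹, ← mul_assoc (𝒜.T j)⁻¹, Matrix.nonsing_inv_mul _ (hdet j),
          one_mul, mul_assoc _ (𝒜.T i)⁻¹, Matrix.nonsing_inv_mul _ (hdet i), mul_one]
    _ = _ := by rw [h, smul_mul_assoc, one_mul]

theorem elt_mem_unitaryGroup (𝒜 : OpGroup d k n) (I : Fin k → ZMod d) :
    𝒜.elt I ∈ Matrix.unitaryGroup n ℂ := by
  have h : (List.ofFn fun i => 𝒜.T i ^ (I i).val).prod ∈ Matrix.unitaryGroup n ℂ := by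
    refine Submonoid.list_prod_mem _ fun x hx => ?_
    obtain ⟨i, rfl⟩ := (List.mem_ofFn' _ _).1 hx
    exact pow_mem (𝒜.unitary i) _
  rw [Matrix.mem_unitaryGroup_iff] at h ⊢
  rw [elt_eq_smul, star_smul, smul_mul_assoc, mul_smul_comm, h, smul_smul]
  have : 𝒜.α I * star (𝒜.α I) = 1 := by
    rw [Complex.star_def, Complex.mul_conj, Complex.normSq_eq_norm_sq, norm_α]; simp
  rw [this, one_smul]

/-- Two elements commute up to the phase given by the bilinear form `(I, J) ↦ I ⬝ᵥ γ *ᵥ J`. -/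
theorem elt_mul_elt_comm [NeZero d] (𝒜 : OpGroup d k n) {γ : Matrix (Fin k) (Fin k) (ZMod d)}
    (hγ : 𝒜.IsGeneratingMatrix γ) (I J : Fin k → ZMod d) :
    𝒜.elt I * 𝒜.elt J = (ZMod.stdAddChar (Matrix.toBilin' γ I J) : ℂ) • (𝒜.elt J * 𝒜.elt I) := by
  have h1 : ∀ i j, 𝒜.T i ^ (I i).val * 𝒜.T j ^ (J j).val =
      (ZMod.stdAddChar (I i * γ i j * J j) : ℂ) • (𝒜.T j ^ (J j).val * 𝒜.T i ^ (I i).val) := by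
    intro i j
    have := mul_pow_comm_smul (pow_mul_comm_smul (𝒜.T_mul_T hγ i j) (I i).val) (J j).val
    rw [← AddChar.map_nsmul_eq_pow, ← AddChar.map_nsmul_eq_pow] at this
    rw [this]
    simp only [nsmul_eq_mul, ZMod.natCast_zmod_val]
    rw [mul_comm]
  have h2 := prod_ofFn_mul_comm_smul _ _ _ fun i =>
    mul_prod_ofFn_comm_smul _ (𝒜.T i ^ (I i).val) _ (h1 i)
  rw [elt_eq_smul, elt_eq_smul, smul_mul_smul_comm, smul_mul_smul_comm, h2, smul_smul, smul_smul,
    Matrix.toBilin'_apply]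
  simp_rw [stdAddChar_sum]
  congr 1
  ring

/-- The ordinary product of `A_I` and `A_J` agrees with `A_I ⊙ A_J = A_{I+J}` up to a unit scalar. -/
theorem elt_mul_elt [Fact d.Prime] (𝒜 : OpGroup d k n) {γ : Matrix (Fin k) (Fin k) (ZMod d)}
    (hγ : 𝒜.IsGeneratingMatrix γ) (I J : Fin k → ZMod d) :
    ∃ c : ℂ, ‖c‖ = 1 ∧ 𝒜.elt I * 𝒜.elt J = c • 𝒜.elt (I + J) := by
  have h1 : ∀ i j, 𝒜.T i ^ (I i).val * 𝒜.T j ^ (J j).val =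
      ((ZMod.stdAddChar (γ i j) : ℂ) ^ (I i).val) ^ (J j).val •
        (𝒜.T j ^ (J j).val * 𝒜.T i ^ (I i).val) := fun i j =>
    mul_pow_comm_smul (pow_mul_comm_smul (𝒜.T_mul_T hγ i j) (I i).val) (J j).val
  obtain ⟨a, ha, e⟩ := prod_ofFn_mul_prod_ofFn _ _ _ (fun i j => by simp) h1
  have h2 : (fun i => 𝒜.T i ^ (I i).val * 𝒜.T i ^ (J i).val) =
      fun i => 𝒜.T i ^ ((I + J) i).val := by
    funext i
    rw [← pow_add, Pi.add_apply, ZMod.val_add, ← pow_eq_pow_mod _ (𝒜.pow_eq_one i)]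
  refine ⟨𝒜.α I * 𝒜.α J * a * (𝒜.α (I + J))⁻¹, by simp [ha, norm_α], ?_⟩
  have h0 : 𝒜.α (I + J) ≠ 0 := by
    rw [← norm_ne_zero_iff, norm_α]; exact one_ne_zero
  rw [elt_eq_smul, elt_eq_smul, smul_mul_smul_comm, e, h2, elt_eq_smul, smul_smul, smul_smul,
    inv_mul_cancel_right₀ h0]

/-- `A_I` is invertible and commutes with itself, so the phase `ω ^ β(I, I)` is `1`. -/
theorem isAlt_toBilin' [Fact d.Prime] [Nonempty n] (𝒜 : OpGroup d k n)
    {γ : Matrix (Fin k) (Fin k) (ZMod d)} (hγ : 𝒜.IsGeneratingMatrix γ) :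
    (Matrix.toBilin' γ).IsAlt := by
  intro I
  have h := 𝒜.elt_mul_elt_comm hγ I I
  have hne : 𝒜.elt I * 𝒜.elt I ≠ 0 := by
    have hu := mul_mem (𝒜.elt_mem_unitaryGroup I) (𝒜.elt_mem_unitaryGroup I)
    intro h0
    rw [h0, Matrix.mem_unitaryGroup_iff] at hu
    simp at hu
  have h1 : (ZMod.stdAddChar (Matrix.toBilin' γ I I) : ℂ) = 1 := by
    have : ((ZMod.stdAddChar (Matrix.toBilin' γ I I) : ℂ) - 1) • (𝒜.elt I * 𝒜.elt I) = 0 := by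
      rw [sub_smul, one_smul, ← h, sub_self]
    exact sub_eq_zero.1 ((smul_eq_zero.1 this).resolve_right hne)
  exact ZMod.injective_stdAddChar (h1.trans (AddChar.map_zero_eq_one _).symm)

end OpGroup

/-! ### Expectation values in a state -/

section States

variable {n : Type*} [Fintype n]

theorem IsState.trace_conjTranspose_mul {ρ : Matrix n n ℂ} (hρ : IsState ρ) (X : Matrix n n ℂ) :
    (Xᴴ * ρ).trace = star (X * ρ).trace := by
  rw [← Matrix.trace_conjTranspose, Matrix.conjTranspose_mul, hρ.1.isHermitian.eq,
    Matrix.trace_mul_comm]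

/-- The variance of an arbitrary (not necessarily normal) operator `X` in a state is nonnegative:
`|⟨X⟩|² ≤ ⟨X†X⟩`. -/
theorem IsState.norm_trace_sq_le [DecidableEq n] {ρ : Matrix n n ℂ} (hρ : IsState ρ)
    (X : Matrix n n ℂ) :
    ‖(X * ρ).trace‖ ^ 2 ≤ ((Xᴴ * X) * ρ).trace.re := by
  set t := (X * ρ).trace with ht
  have htc : (Xᴴ * ρ).trace = star t := hρ.trace_conjTranspose_mul X
  -- `⟨(X - ⟨X⟩)† (X - ⟨X⟩)⟩` is the trace of a positive semidefinite matrix.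
  have h := (hρ.1.mul_mul_conjTranspose_same (X - t • 1)).trace_nonneg
  have e : ((X - t • 1) * ρ * (X - t • 1)ᴴ).trace = ((Xᴴ * X) * ρ).trace - (‖t‖ ^ 2 : ℝ) := by
    have h1 : star t * t = (‖t‖ ^ 2 : ℝ) := by
      rw [mul_comm, Complex.star_def, Complex.mul_conj, Complex.normSq_eq_norm_sq]
    rw [Matrix.trace_mul_comm, ← mul_assoc, Matrix.conjTranspose_sub, Matrix.conjTranspose_smul,
      Matrix.conjTranspose_one]
    simp only [sub_mul, mul_sub, smul_mul_assoc, mul_smul_comm, one_mul, mul_one,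
      Matrix.trace_sub, Matrix.trace_smul, htc, hρ.2, smul_eq_mul, ← ht, ← h1]
    ring
  rw [e, Complex.nonneg_iff] at h
  have := h.1
  rw [Complex.sub_re, Complex.ofReal_re] at this
  linarith

theorem IsState.norm_trace_le_one [DecidableEq n] {ρ : Matrix n n ℂ} (hρ : IsState ρ)
    {U : Matrix n n ℂ}
    (hU : U ∈ Matrix.unitaryGroup n ℂ) : ‖(U * ρ).trace‖ ^ 2 ≤ 1 := by
  have h := hρ.norm_trace_sq_le U
  rw [← Matrix.star_eq_conjTranspose, Matrix.mem_unitaryGroup_iff'.1 hU, one_mul, hρ.2] at h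
  simpa using h

theorem IsState.kronecker {ρ σ : Matrix n n ℂ} (hρ : IsState ρ) (hσ : IsState σ) :
    IsState (ρ ⊗ₖ σ) :=
  ⟨hρ.1.kronecker hσ.1, by rw [Matrix.trace_kronecker, hρ.2, hσ.2, one_mul]⟩

theorem trace_kronecker_mul_kronecker (A B ρ σ : Matrix n n ℂ) :
    ((A ⊗ₖ B) * (ρ ⊗ₖ σ)).trace = (A * ρ).trace * (B * σ).trace := by
  rw [← Matrix.trace_kronecker, Matrix.mul_kronecker_mul]

end States

/-! ### The upper bound -/

namespace OpGroup

variable {d k : ℕ} {n : Type*} [Fintype n] [DecidableEq n]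

theorem elt_conjTranspose_mul_self (𝒜 : OpGroup d k n) (I : Fin k → ZMod d) :
    (𝒜.elt I)ᴴ * 𝒜.elt I = 1 :=
  Matrix.mem_unitaryGroup_iff'.1 (𝒜.elt_mem_unitaryGroup I)

theorem elt_mul_conjTranspose_self (𝒜 : OpGroup d k n) (I : Fin k → ZMod d) :
    𝒜.elt I * (𝒜.elt I)ᴴ = 1 :=
  Matrix.mem_unitaryGroup_iff.1 (𝒜.elt_mem_unitaryGroup I)

/-- The phase of `A_{I+K}` relative to `A_I A_K` cancels in the tensor product, leaving only the
commutation phase. -/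
theorem kronecker_conjTranspose_mul_kronecker [Fact d.Prime] (𝒜 : OpGroup d k n)
    {γ : Matrix (Fin k) (Fin k) (ZMod d)} (hγ : 𝒜.IsGeneratingMatrix γ) (I K : Fin k → ZMod d) :
    (𝒜.elt I ⊗ₖ (𝒜.elt I)ᴴ)ᴴ *
        (𝒜.elt (I + K) ⊗ₖ (𝒜.elt (I + K))ᴴ) =
      (ZMod.stdAddChar (Matrix.toBilin' γ K I) : ℂ) •
        (𝒜.elt K ⊗ₖ (𝒜.elt K)ᴴ) := by
  obtain ⟨c, hc, e⟩ := 𝒜.elt_mul_elt hγ I K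
  have hcc : c * star c = 1 := by
    rw [Complex.star_def, Complex.mul_conj, Complex.normSq_eq_norm_sq, hc]; simp
  have e' : 𝒜.elt (I + K) = star c • (𝒜.elt I * 𝒜.elt K) := by
    rw [e, smul_smul, mul_comm, hcc, one_smul]
  have h1 : 𝒜.elt I * (𝒜.elt K)ᴴ =
      (ZMod.stdAddChar (Matrix.toBilin' γ K I) : ℂ) • ((𝒜.elt K)ᴴ * 𝒜.elt I) := by
    calc 𝒜.elt I * (𝒜.elt K)ᴴ
        = (𝒜.elt K)ᴴ * (𝒜.elt K * 𝒜.elt I) * (𝒜.elt K)ᴴ := by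
          rw [← mul_assoc, elt_conjTranspose_mul_self, one_mul]
      _ = _ := by
          rw [𝒜.elt_mul_elt_comm hγ K I, mul_smul_comm, smul_mul_assoc, mul_assoc, mul_assoc,
            elt_mul_conjTranspose_self, mul_one]
  have h2 : (𝒜.elt I)ᴴ * 𝒜.elt (I + K) = star c • 𝒜.elt K := by
    rw [e', mul_smul_comm, ← mul_assoc, elt_conjTranspose_mul_self, one_mul]
  have h3 : 𝒜.elt I * (𝒜.elt (I + K))ᴴ =
      (c * ZMod.stdAddChar (Matrix.toBilin' γ K I)) • (𝒜.elt K)ᴴ := by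
    rw [e', Matrix.conjTranspose_smul, star_star, Matrix.conjTranspose_mul, mul_smul_comm,
      ← mul_assoc, h1, smul_mul_assoc, mul_assoc, elt_mul_conjTranspose_self, mul_one, smul_smul]
  rw [Matrix.conjTranspose_kronecker,
    Matrix.conjTranspose_conjTranspose, ← Matrix.mul_kronecker_mul, h2, h3,
    Matrix.smul_kronecker, Matrix.kronecker_smul, smul_smul, ← mul_assoc, mul_comm (star c), hcc,
    one_mul]

/-- The kernel of `γ` is the right radical of its bilinear form. -/
theorem mem_ker_mulVecLin_iff [Fact d.Prime] {γ : Matrix (Fin k) (Fin k) (ZMod d)}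
    {J : Fin k → ZMod d} :
    J ∈ LinearMap.ker γ.mulVecLin ↔ ∀ I, Matrix.toBilin' γ I J = 0 := by
  simp only [LinearMap.mem_ker, Matrix.mulVecLin_apply, Matrix.toBilin'_apply']
  constructor
  · intro h I; rw [h, dotProduct_zero]
  · intro h
    exact dotProduct_eq_zero _ fun w => by rw [dotProduct_comm]; exact h w

/-- Orthogonality of characters: `I ↦ ω ^ β(K, I)` is a character, trivial exactly for `K ∈ ker γ`. -/
theorem sum_stdAddChar_bilin [Fact d.Prime] {γ : Matrix (Fin k) (Fin k) (ZMod d)}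
    (hγ : (Matrix.toBilin' γ).IsAlt) (K : Fin k → ZMod d)
    [Decidable (K ∈ LinearMap.ker γ.mulVecLin)] :
    ∑ I, (ZMod.stdAddChar (Matrix.toBilin' γ K I) : ℂ) =
      if K ∈ LinearMap.ker γ.mulVecLin then (d : ℂ) ^ k else 0 := by
  split_ifs with h
  · have h0 : ∀ I, Matrix.toBilin' γ K I = 0 := fun I => by
      rw [← hγ.neg_eq I K, mem_ker_mulVecLin_iff.1 h I, neg_zero]
    simp [h0, ZMod.card]
  · obtain ⟨I, hI⟩ := not_forall.1 fun h' => h (mem_ker_mulVecLin_iff.2 h')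
    let ψ : AddChar (Fin k → ZMod d) ℂ :=
      (ZMod.stdAddChar (N := d)).compAddMonoidHom (Matrix.toBilin' γ K).toAddMonoidHom
    have hψ : ψ ≠ 0 := by
      refine AddChar.ne_zero_iff.2 ⟨I, fun h1 => hI ?_⟩
      have : Matrix.toBilin' γ K I = 0 :=
        ZMod.injective_stdAddChar (h1.trans (AddChar.map_zero_eq_one _).symm)
      rw [← hγ.neg_eq K I, this, neg_zero]
    exact AddChar.sum_eq_zero_iff_ne_zero.2 hψ

theorem natCard_radical [Fact d.Prime] (γ : Matrix (Fin k) (Fin k) (ZMod d)) :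
    Nat.card (LinearMap.ker γ.mulVecLin) = d ^ nullity γ := by
  rw [Module.natCard_eq_pow_finrank (K := ZMod d), Nat.card_zmod]; rfl

/-- The upper bound, in squared form: the variance inequality in the state `ρ ⊗ ρ` for
`S = ∑_I A_I ⊗ A_I†`. -/
theorem sumSq_sq_le [Fact d.Prime] [Nonempty n] (𝒜 : OpGroup d k n)
    {γ : Matrix (Fin k) (Fin k) (ZMod d)} (hγ : 𝒜.IsGeneratingMatrix γ) {ρ : Matrix n n ℂ}
    (hρ : IsState ρ) : 𝒜.sumSq ρ ^ 2 ≤ (d : ℝ) ^ (nullity γ + k) := by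
  classical
  let M : (Fin k → ZMod d) → Matrix (n × n) (n × n) ℂ := fun I =>
    𝒜.elt I ⊗ₖ (𝒜.elt I)ᴴ
  have hM : ∀ I, (M I * (ρ ⊗ₖ ρ)).trace = (‖(𝒜.elt I * ρ).trace‖ ^ 2 : ℝ) := by
    intro I
    rw [trace_kronecker_mul_kronecker, hρ.trace_conjTranspose_mul, Complex.star_def,
      Complex.mul_conj, Complex.normSq_eq_norm_sq]
  have h1 : ((∑ I, M I) * (ρ ⊗ₖ ρ)).trace = (𝒜.sumSq ρ : ℝ) := by
    rw [Finset.sum_mul, Matrix.trace_sum, sumSq, Complex.ofReal_sum]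
    exact Finset.sum_congr rfl fun I _ => hM I
  have h2 : (∑ I, M I)ᴴ * (∑ I, M I) =
      ∑ K, (∑ I, (ZMod.stdAddChar (Matrix.toBilin' γ K I) : ℂ)) • M K := by
    rw [Matrix.conjTranspose_sum, Finset.sum_mul_sum]
    simp_rw [Finset.sum_smul]
    refine Eq.trans ?_ Finset.sum_comm
    refine Finset.sum_congr rfl fun I _ => ?_
    -- substitute `J = I + K` in the second summation index
    rw [← Equiv.sum_comp (Equiv.addLeft I)]
    exact Finset.sum_congr rfl fun K _ => 𝒜.kronecker_conjTranspose_mul_kronecker hγ I K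
  have h3 : (((∑ I, M I)ᴴ * (∑ I, M I)) * (ρ ⊗ₖ ρ)).trace.re =
      ∑ K : Fin k → ZMod d, if K ∈ LinearMap.ker γ.mulVecLin then
        (d : ℝ) ^ k * ‖(𝒜.elt K * ρ).trace‖ ^ 2 else 0 := by
    rw [h2, Finset.sum_mul, Matrix.trace_sum, Complex.re_sum]
    refine Finset.sum_congr rfl fun K _ => ?_
    rw [smul_mul_assoc, Matrix.trace_smul, hM, sum_stdAddChar_bilin (𝒜.isAlt_toBilin' hγ)]
    split_ifs
    · rw [smul_eq_mul, ← Complex.ofReal_natCast, ← Complex.ofReal_pow, ← Complex.ofReal_mul,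
        Complex.ofReal_re]
    · simp
  have h4 := (hρ.kronecker hρ).norm_trace_sq_le (∑ I, M I)
  rw [h1, h3, Complex.norm_real, Real.norm_eq_abs, sq_abs] at h4
  refine h4.trans ?_
  rw [← Finset.sum_filter, ← Finset.mul_sum, pow_add, mul_comm]
  gcongr
  refine (Finset.sum_le_sum fun K _ => hρ.norm_trace_le_one (𝒜.elt_mem_unitaryGroup K)).trans ?_
  rw [Finset.sum_const, nsmul_eq_mul, mul_one]
  have : (Finset.univ.filter fun K => K ∈ LinearMap.ker γ.mulVecLin).card = d ^ nullity γ := by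
    rw [← natCard_radical, Nat.card_eq_fintype_card, Fintype.card_subtype]
  rw [this, Nat.cast_pow]

end OpGroup

/-! ### Maximal isotropic subspaces -/

section Isotropic

variable {K V : Type*} [Field K] [AddCommGroup V] [Module K V] [FiniteDimensional K V]

/-- A maximal isotropic subspace of an alternating form equals its orthogonal: any vector orthogonal to
it is isotropic, so could be adjoined. -/
theorem exists_orthogonal_eq_self {B : LinearMap.BilinForm K V} (hB : B.IsAlt) :
    ∃ W : Submodule K V, B.orthogonal W = W := by
  obtain ⟨W, hW⟩ := exists_maximal_of_wellFoundedGT (fun W : Submodule K V => W ≤ B.orthogonal W)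
    ⟨⊥, bot_le⟩
  refine ⟨W, le_antisymm (fun v hv => ?_) hW.prop⟩
  have hswap : ∀ x ∈ W, B v x = 0 := fun x hx => by
    rw [← hB.neg_eq, (LinearMap.BilinForm.mem_orthogonal_iff.1 hv x hx : B x v = 0), neg_zero]
  have hsup : W ⊔ Submodule.span K {v} ≤ B.orthogonal (W ⊔ Submodule.span K {v}) := by
    intro x hx
    rw [LinearMap.BilinForm.mem_orthogonal_iff]
    intro y hy
    obtain ⟨w, hw, _, hz, rfl⟩ := Submodule.mem_sup.1 hx
    obtain ⟨a, rfl⟩ := Submodule.mem_span_singleton.1 hz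
    obtain ⟨u, hu, _, hz', rfl⟩ := Submodule.mem_sup.1 hy
    obtain ⟨b, rfl⟩ := Submodule.mem_span_singleton.1 hz'
    have h1 : B u w = 0 := LinearMap.BilinForm.mem_orthogonal_iff.1 (hW.prop hw) u hu
    have h2 : B u v = 0 := LinearMap.BilinForm.mem_orthogonal_iff.1 hv u hu
    change B (u + b • v) (w + a • v) = 0
    simp [h1, h2, hswap w hw, hB.self_eq_zero]
  exact hW.le_of_ge hsup le_sup_left (Submodule.mem_sup_right (Submodule.mem_span_singleton_self v))

theorem two_mul_finrank_of_orthogonal_eq_self {B : LinearMap.BilinForm K V}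
    {W : Submodule K V} (hW : B.orthogonal W = W) (hker : LinearMap.ker B ≤ W) :
    2 * Module.finrank K W = Module.finrank K (LinearMap.ker B) + Module.finrank K V := by
  have h := LinearMap.BilinForm.finrank_add_finrank_orthogonal' (B := B) W
  rw [hW, inf_eq_right.2 hker] at h
  omega

end Isotropic

/-! ### Joint eigenvectors -/

section JointEigenvector

/-- Commuting operators of finite order over `ℂ` are semisimple, so their joint generalised eigenspaces
are joint eigenspaces. -/
theorem exists_joint_eigenvector {ι M : Type*} [AddCommGroup M] [Module ℂ M]
    [FiniteDimensional ℂ M] [Nontrivial M] (f : ι → Module.End ℂ M)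
    (hf : ∀ i j, Commute (f i) (f j)) {d : ℕ} (hd : d ≠ 0) (hp : ∀ i, f i ^ d = 1) :
    ∃ v : M, v ≠ 0 ∧ ∀ i, ∃ μ : ℂ, f i v = μ • v := by
  have hss : ∀ i, (f i).IsSemisimple := fun i => by
    have hsq : Squarefree (Polynomial.X ^ d - 1 : Polynomial ℂ) :=
      (Polynomial.X_pow_sub_one_separable_iff.2 (by exact_mod_cast hd)).squarefree
    exact Module.End.isSemisimple_of_squarefree_aeval_eq_zero hsq (by simp [hp i])
  have htop := Module.End.iSup_iInf_maxGenEigenspace_eq_top_of_iSup_maxGenEigenspace_eq_top_of_commute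
    f (fun i j _ => hf i j) fun i => Module.End.iSup_maxGenEigenspace_eq_top (f i)
  obtain ⟨χ, hχ⟩ : ∃ χ : ι → ℂ, ⨅ i, (f i).maxGenEigenspace (χ i) ≠ ⊥ := by
    by_contra! h
    rw [iSup_eq_bot.2 h] at htop
    exact bot_ne_top htop
  obtain ⟨v, hv, hv0⟩ := Submodule.exists_mem_ne_zero_of_ne_bot hχ
  refine ⟨v, hv0, fun i => ⟨χ i, ?_⟩⟩
  have := (Submodule.mem_iInf _).1 hv i
  rw [(hss i).isFinitelySemisimple.maxGenEigenspace_eq_eigenspace] at this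
  exact Module.End.mem_eigenspace_iff.1 this

end JointEigenvector

/-! ### Pure states -/

section Pure

variable {n : Type*} [Fintype n]

theorem trace_mul_vecMulVec (A : Matrix n n ℂ) (ψ : n → ℂ) :
    (A * Matrix.vecMulVec ψ (star ψ)).trace = (A *ᵥ ψ) ⬝ᵥ star ψ := by
  rw [Matrix.mul_vecMulVec, Matrix.trace_vecMulVec]

theorem norm_eigenvalue_of_mem_unitaryGroup [DecidableEq n] {U : Matrix n n ℂ}
    (hU : U ∈ Matrix.unitaryGroup n ℂ)
    {v : n → ℂ} (hv : v ≠ 0) {μ : ℂ} (h : U *ᵥ v = μ • v) : ‖μ‖ = 1 := by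
  have h1 : star (U *ᵥ v) ⬝ᵥ (U *ᵥ v) = star v ⬝ᵥ v := by
    rw [Matrix.star_mulVec, Matrix.dotProduct_mulVec, Matrix.vecMul_vecMul,
      ← Matrix.star_eq_conjTranspose, Matrix.mem_unitaryGroup_iff'.1 hU, Matrix.vecMul_one]
  have h0 : star v ⬝ᵥ v ≠ 0 := fun h0 => hv (dotProduct_star_self_eq_zero.1 h0)
  rw [h, star_smul, smul_dotProduct, dotProduct_smul, smul_smul, smul_eq_mul] at h1
  have h2 : star μ * μ = 1 := mul_right_cancel₀ h0 (h1.trans (one_mul _).symm)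
  rw [mul_comm, Complex.star_def, Complex.mul_conj, Complex.normSq_eq_norm_sq] at h2
  have h3 : ‖μ‖ ^ 2 = 1 := by exact_mod_cast h2
  exact (pow_eq_one_iff_of_nonneg (norm_nonneg _) two_ne_zero).1 h3

theorem exists_smul_dotProduct_star_eq_one {v : n → ℂ} (hv : v ≠ 0) :
    ∃ c : ℂ, (c • v) ⬝ᵥ star (c • v) = 1 := by
  have h0 : v ⬝ᵥ star v ≠ 0 := fun h0 => hv (dotProduct_self_star_eq_zero.1 h0)
  have hnn : 0 ≤ v ⬝ᵥ star v := dotProduct_self_star_nonneg v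
  obtain ⟨r, hr, hrv⟩ : ∃ r : ℝ, 0 < r ∧ v ⬝ᵥ star v = r := by
    obtain ⟨h1, h2⟩ := Complex.nonneg_iff.1 hnn
    have e : v ⬝ᵥ star v = ((v ⬝ᵥ star v).re : ℂ) := Complex.ext (by simp) (by simp [← h2])
    exact ⟨_, lt_of_le_of_ne h1 fun h => h0 (by rw [e, ← h]; simp), e⟩
  refine ⟨((Real.sqrt r)⁻¹ : ℝ), ?_⟩
  rw [star_smul, smul_dotProduct, dotProduct_smul, smul_smul, hrv, smul_eq_mul, Complex.star_def,
    Complex.conj_ofReal, ← Complex.ofReal_mul, ← Complex.ofReal_mul, ← mul_inv,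
    Real.mul_self_sqrt hr.le, inv_mul_cancel₀ hr.ne', Complex.ofReal_one]

end Pure

/-! ### Cliques of the commutation graph -/

namespace OpGroup

variable {d k : ℕ} {n : Type*} [Fintype n] [DecidableEq n]

/-- A joint eigenvector of the operators in a clique gives a pure state whose sum of squares is at
least the size of the clique. -/
theorem exists_isPureState_card_le_sumSq [Fact d.Prime] [Nonempty n] (𝒜 : OpGroup d k n)
    {C : Finset (Fin k → ZMod d)} (hC : 𝒜.commGraph.IsClique C) :
    ∃ ρ, IsPureState ρ ∧ (C.card : ℝ) ≤ 𝒜.sumSq ρ := by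
  have hcomm : ∀ I J : C, Commute (Matrix.toLin' (𝒜.elt I)) (Matrix.toLin' (𝒜.elt J)) := by
    intro I J
    have h : Commute (𝒜.elt I) (𝒜.elt J) := by
      by_cases hIJ : (I : Fin k → ZMod d) = J
      · rw [hIJ]
      · exact (hC I.2 J.2 hIJ).2
    exact h.map (Matrix.toLinAlgEquiv' (R := ℂ) (n := n))
  obtain ⟨v, hv, h⟩ := exists_joint_eigenvector (fun I : C => Matrix.toLin' (𝒜.elt I)) hcomm
    (Nat.Prime.ne_zero Fact.out : d ≠ 0) fun I => by
      have : 𝒜.elt I ^ d = 1 := 𝒜.word_pow_eq_one I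
      rw [← Matrix.toLin'_pow, this, Matrix.toLin'_one]; rfl
  obtain ⟨c, hc⟩ := exists_smul_dotProduct_star_eq_one hv
  refine ⟨Matrix.vecMulVec (c • v) (star (c • v)),
    ⟨⟨Matrix.posSemidef_vecMulVec_self_star _, by rw [Matrix.trace_vecMulVec, hc]⟩, _, rfl⟩, ?_⟩
  have hone : ∀ I ∈ C,
      ‖(𝒜.elt I * Matrix.vecMulVec (c • v) (star (c • v))).trace‖ ^ 2 = 1 := by
    intro I hI
    obtain ⟨μ, hμ⟩ := h ⟨I, hI⟩
    rw [Matrix.toLin'_apply] at hμ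
    rw [trace_mul_vecMulVec, Matrix.mulVec_smul, hμ, smul_comm, smul_dotProduct, hc, smul_eq_mul,
      mul_one, norm_eigenvalue_of_mem_unitaryGroup (𝒜.elt_mem_unitaryGroup I) hv hμ, one_pow]
  calc (C.card : ℝ) = ∑ I ∈ C, ‖(𝒜.elt I * Matrix.vecMulVec (c • v) (star (c • v))).trace‖ ^ 2 := by
        rw [Finset.sum_congr rfl hone]; simp
    _ ≤ _ := Finset.sum_le_sum_of_subset_of_nonneg (Finset.subset_univ _) fun _ _ _ => sq_nonneg _

/-- A maximal isotropic subspace of `ℤ_d^k` is a clique with `d ^ ((null γ + k) / 2)` elements. -/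
theorem exists_isClique_card_sq [Fact d.Prime] [Nonempty n] (𝒜 : OpGroup d k n)
    {γ : Matrix (Fin k) (Fin k) (ZMod d)} (hγ : 𝒜.IsGeneratingMatrix γ) :
    ∃ C : Finset (Fin k → ZMod d), 𝒜.commGraph.IsClique C ∧ C.card ^ 2 = d ^ (nullity γ + k) := by
  classical
  have hB := 𝒜.isAlt_toBilin' hγ
  obtain ⟨W, hW⟩ := exists_orthogonal_eq_self hB
  have hkerB : LinearMap.ker (Matrix.toBilin' γ) = LinearMap.ker γ.mulVecLin := by
    ext J
    rw [mem_ker_mulVecLin_iff, LinearMap.mem_ker, LinearMap.ext_iff]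
    exact forall_congr' fun I => by rw [← hB.neg_eq J I, neg_eq_zero, LinearMap.zero_apply]
  have hker : LinearMap.ker (Matrix.toBilin' γ) ≤ W := by
    intro J hJ
    rw [← hW, LinearMap.BilinForm.mem_orthogonal_iff]
    intro I _
    rw [hkerB] at hJ
    exact mem_ker_mulVecLin_iff.1 hJ I
  have hdim := two_mul_finrank_of_orthogonal_eq_self hW hker
  rw [hkerB, Module.finrank_fin_fun] at hdim
  refine ⟨Finset.univ.filter (· ∈ W), ?_, ?_⟩
  · intro I hI J hJ hne
    refine ⟨hne, ?_⟩
    simp only [Finset.coe_filter, Finset.mem_univ, true_and, Set.mem_ofPred_eq] at hI hJ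
    rw [← hW] at hJ
    have h0 : Matrix.toBilin' γ I J = 0 := LinearMap.BilinForm.mem_orthogonal_iff.1 hJ I hI
    have h := 𝒜.elt_mul_elt_comm hγ I J
    rwa [h0, AddChar.map_zero_eq_one, one_smul] at h
  · have hcard : (Finset.univ.filter (· ∈ W)).card = d ^ Module.finrank (ZMod d) W := by
      rw [← Fintype.card_subtype, ← Nat.card_eq_fintype_card]
      exact (Module.natCard_eq_pow_finrank (K := ZMod d)).trans (by rw [Nat.card_zmod])
    rw [hcard, ← pow_mul, mul_comm, hdim, nullity]

end OpGroup

end QuditGroup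

theorem theorem2 (d k : ℕ) [Fact d.Prime] {n : Type*} [Fintype n] [DecidableEq n] [Nonempty n]
    (𝒜 : QuditGroup.OpGroup d k n) (γ : Matrix (Fin k) (Fin k) (ZMod d))
    (hγ : 𝒜.IsGeneratingMatrix γ) :
    (∀ ρ : Matrix n n ℂ, QuditGroup.IsState ρ →
      𝒜.sumSq ρ ≤ (d : ℝ) ^ (((QuditGroup.nullity γ : ℝ) + (k : ℝ)) / 2)) ∧
    (d : ℝ) ^ (((QuditGroup.nullity γ : ℝ) + (k : ℝ)) / 2) = (𝒜.commGraph.cliqueNum : ℝ) ∧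
    (∃ ρ : Matrix n n ℂ, QuditGroup.IsPureState ρ ∧
      𝒜.sumSq ρ = (d : ℝ) ^ (((QuditGroup.nullity γ : ℝ) + (k : ℝ)) / 2)) := by
  set b : ℝ := (d : ℝ) ^ (((QuditGroup.nullity γ : ℝ) + (k : ℝ)) / 2) with hb
  have hb0 : 0 ≤ b := by positivity
  have hb2 : b ^ 2 = (d : ℝ) ^ (QuditGroup.nullity γ + k) := by
    rw [hb, ← Real.rpow_natCast, ← Real.rpow_mul (Nat.cast_nonneg d), ← Real.rpow_natCast]
    congr 1
    push_cast
    ring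
  have hupper : ∀ ρ : Matrix n n ℂ, QuditGroup.IsState ρ → 𝒜.sumSq ρ ≤ b := fun ρ hρ =>
    (sq_le_sq₀ (Finset.sum_nonneg fun _ _ => sq_nonneg _) hb0).1
      ((𝒜.sumSq_sq_le hγ hρ).trans_eq hb2.symm)
  have hclique : ∀ C : Finset (Fin k → ZMod d), 𝒜.commGraph.IsClique C → (C.card : ℝ) ≤ b := by
    intro C hC
    obtain ⟨ρ, hρ, h⟩ := 𝒜.exists_isPureState_card_le_sumSq hC
    exact h.trans (hupper ρ hρ.1)
  obtain ⟨C, hC, hcard⟩ := 𝒜.exists_isClique_card_sq hγ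
  have hCb : (C.card : ℝ) = b := by
    refine (pow_left_inj₀ (Nat.cast_nonneg _) hb0 two_ne_zero).1 ?_
    rw [hb2]
    exact_mod_cast hcard
  refine ⟨hupper, le_antisymm ?_ ?_, ?_⟩
  · rw [← hCb, Nat.cast_le]
    exact hC.card_le_cliqueNum
  · obtain ⟨D, hD⟩ := 𝒜.commGraph.exists_isNClique_cliqueNum
    rw [← hD.card_eq]
    exact hclique D hD.isClique
  · obtain ⟨ρ, hρ, h⟩ := 𝒜.exists_isPureState_card_le_sumSq hC
    exact ⟨ρ, hρ, le_antisymm (hupper ρ hρ.1) (hCb ▸ h)⟩
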